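/- The zero-pattern of a matrix $X=[X_{i,j}]$ over a field is the $(0,1)$-matrix $\underline{X}$ of the same size with $\underline{X}_{i,j}=1$ if $X_{i,j}\neq 0$ and $\underline{X}_{i,j}=0$ if $X_{i,j}=0$. Let $U(n)$ denote the set of complex $n\times n$ matrices $X$ with $XX^{\dagger}=I$, let $O(n)$ denote the set of real $n\times n$ matrices $Y$ with $YY^{T}=I$, and let $O_n(\mathbb{Q})$ denote the set of those matrices in $O(n)$ all of whose entries are rational. **Theorem.** Let $n\le 5$. Then: 1. for every $X\in U(n)$ there exists $Y\in O(n)$ such that $\underline{X}=\underline{Y}$; 2. for every $Y\in O(n)$ there exists $Z\in O_n(\mathbb{Q})$ such that $\underline{Y}=\underline{Z}$. -/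

import Mathlib

/-- The zero-pattern (support) of a matrix `X` over a field: the `(0,1)`-matrix whose entry at
`(i, j)` is `1` if `X i j ≠ 0` and `0` if `X i j = 0`. -/
noncomputable def zeroPattern {m n K : Type*} [Field K] (X : Matrix m n K) : Matrix m n ℕ :=
  open Classical in Matrix.of fun i j => if X i j ≠ 0 then 1 else 0

/-- The set of rational orthogonal matrices of size `n`: the real orthogonal matrices all of whose
entries are rational. -/
def rationalOrthogonal (n : ℕ) : Set (Matrix (Fin n) (Fin n) ℝ) :=
  {X | X ∈ Matrix.orthogonalGroup (Fin n) ℝ ∧ ∀ i j, ∃ q : ℚ, (q : ℝ) = X i j}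

open scoped Matrix

/-! Both claims follow from one stronger fact: for `n ≤ 5` the support of a complex unitary matrix
is the support of a rational orthogonal one. A rational orthogonal matrix is real orthogonal, and a
real orthogonal matrix is unitary over `ℂ`.

The proof is by induction on the size. A row with one nonzero entry splits off. A row with two
nonzero entries makes its two columns proportional below it, so they merge into one column of a
smaller unitary matrix; a rational solution for the smaller pattern is unmerged with a rational
rotation (`IsRationalPattern.of_first_row_single`, `IsRationalPattern.of_first_row_pair`). Columns
are handled by transposing.

What remains are patterns with at least three entries in every row and column. Nonzero pairwise
orthogonal vectors on a column set `T` number at most `T.card`; this yields the combinatorial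
constraints `card_common_ne_one`, `two_lt_card_majority` and `le_of_equal_rows`. A search adding one
row at a time lists all patterns that meet them, up to permutations
(`IsReducedPattern.exists_mem_level`). Each survivor whose transpose also passes is, up to
permutations and transposition, the support of an integer matrix `M` with `M * Mᵀ = d ^ 2 • 1` from
an explicit table, and `M / d` is the rational orthogonal matrix sought. -/

/-- The pattern `P` is the support of a complex unitary matrix. -/
def IsUnitaryPattern {n : ℕ} (P : Matrix (Fin n) (Fin n) Bool) : Prop :=
  ∃ X ∈ Matrix.unitaryGroup (Fin n) ℂ, ∀ i j, P i j = true ↔ X i j ≠ 0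

/-- The pattern `P` is the support of a rational orthogonal matrix. -/
def IsRationalPattern {n : ℕ} (P : Matrix (Fin n) (Fin n) Bool) : Prop :=
  ∃ Z : Matrix (Fin n) (Fin n) ℚ, Z * Zᵀ = 1 ∧ ∀ i j, P i j = true ↔ Z i j ≠ 0

/-! ### Invariance under permutations and transposition -/

namespace IsUnitaryPattern

variable {n : ℕ} {P : Matrix (Fin n) (Fin n) Bool}

theorem submatrix (h : IsUnitaryPattern P) (σ τ : Equiv.Perm (Fin n)) :
    IsUnitaryPattern (P.submatrix σ τ) := by
  obtain ⟨X, hX, hP⟩ := h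
  refine ⟨X.submatrix σ τ, ?_, fun i j => hP _ _⟩
  rw [Matrix.mem_unitaryGroup_iff] at hX ⊢
  rw [Matrix.star_eq_conjTranspose] at hX ⊢
  rw [Matrix.conjTranspose_submatrix, Matrix.submatrix_mul_equiv, hX, Matrix.submatrix_one_equiv]

theorem transpose (h : IsUnitaryPattern P) : IsUnitaryPattern Pᵀ := by
  obtain ⟨X, hX, hP⟩ := h
  refine ⟨Xᵀ, ?_, fun i j => hP _ _⟩
  rw [Matrix.mem_unitaryGroup_iff', Matrix.star_eq_conjTranspose] at hX
  rw [Matrix.mem_unitaryGroup_iff, Matrix.star_eq_conjTranspose]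
  have := congrArg Matrix.transpose hX
  rwa [Matrix.transpose_mul, Matrix.transpose_one] at this

end IsUnitaryPattern

namespace IsRationalPattern

variable {n : ℕ} {P : Matrix (Fin n) (Fin n) Bool}

theorem submatrix (h : IsRationalPattern P) (σ τ : Equiv.Perm (Fin n)) :
    IsRationalPattern (P.submatrix σ τ) := by
  obtain ⟨Z, hZ, hP⟩ := h
  refine ⟨Z.submatrix σ τ, ?_, fun i j => hP _ _⟩
  rw [Matrix.transpose_submatrix, Matrix.submatrix_mul_equiv, hZ, Matrix.submatrix_one_equiv]

theorem of_submatrix {σ τ : Equiv.Perm (Fin n)} (h : IsRationalPattern (P.submatrix σ τ)) :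
    IsRationalPattern P := by
  simpa using h.submatrix σ.symm τ.symm

theorem transpose (h : IsRationalPattern P) : IsRationalPattern Pᵀ := by
  obtain ⟨Z, hZ, hP⟩ := h
  exact ⟨Zᵀ, by rw [Matrix.transpose_transpose, mul_eq_one_comm.1 hZ], fun i j => hP _ _⟩

theorem of_transpose (h : IsRationalPattern Pᵀ) : IsRationalPattern P := h.transpose

end IsRationalPattern

theorem unitary_row_mul {n : ℕ} {X : Matrix (Fin n) (Fin n) ℂ}
    (hX : X ∈ Matrix.unitaryGroup (Fin n) ℂ) (i k : Fin n) :
    ∑ j, X i j * star (X k j) = if i = k then 1 else 0 := by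
  rw [Matrix.mem_unitaryGroup_iff] at hX
  have := congrFun (congrFun hX i) k
  rwa [Matrix.mul_apply, Matrix.one_apply] at this

theorem mem_unitaryGroup_of_row_mul {n : ℕ} {X : Matrix (Fin n) (Fin n) ℂ}
    (hX : ∀ i k, ∑ j, X i j * star (X k j) = if i = k then 1 else 0) :
    X ∈ Matrix.unitaryGroup (Fin n) ℂ := by
  rw [Matrix.mem_unitaryGroup_iff]
  ext i k
  rw [Matrix.mul_apply, Matrix.one_apply, ← hX i k]
  rfl

theorem mul_transpose_eq_one_of_row_mul {n : ℕ} {Z : Matrix (Fin n) (Fin n) ℚ}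
    (hZ : ∀ i k, ∑ j, Z i j * Z k j = if i = k then 1 else 0) : Z * Zᵀ = 1 := by
  ext i k
  rw [Matrix.mul_apply, Matrix.one_apply, ← hZ i k]
  rfl

theorem rational_row_mul {n : ℕ} {Z : Matrix (Fin n) (Fin n) ℚ} (hZ : Z * Zᵀ = 1) (i k : Fin n) :
    ∑ j, Z i j * Z k j = if i = k then 1 else 0 := by
  have := congrFun (congrFun hZ i) k
  rwa [Matrix.mul_apply, Matrix.one_apply] at this

/-! ### Rows of weight at most two -/

/-- A pattern whose first row has its only entry in the first column reduces to a smaller one. -/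
theorem IsRationalPattern.of_first_row_single {m : ℕ}
    (ih : ∀ P : Matrix (Fin m) (Fin m) Bool, IsUnitaryPattern P → IsRationalPattern P)
    {P : Matrix (Fin (m + 1)) (Fin (m + 1)) Bool} (hU : IsUnitaryPattern P)
    (h0 : ∀ j, P 0 j = true ↔ j = 0) : IsRationalPattern P := by
  obtain ⟨X, hX, hP⟩ := hU
  have hrow := unitary_row_mul hX
  have hz : ∀ j : Fin m, X 0 j.succ = 0 := fun j => by
    by_contra h
    exact Fin.succ_ne_zero j ((h0 _).1 ((hP _ _).2 h))
  have h00 : X 0 0 ≠ 0 := (hP 0 0).1 ((h0 0).2 rfl)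
  have hc : ∀ i : Fin m, X i.succ 0 = 0 := fun i => by
    have := hrow i.succ 0
    simpa [Fin.sum_univ_succ, hz, h00] using this
  have hX' : IsUnitaryPattern (P.submatrix Fin.succ Fin.succ) := by
    refine ⟨X.submatrix Fin.succ Fin.succ, mem_unitaryGroup_of_row_mul fun i k => ?_,
      fun i j => hP _ _⟩
    have := hrow i.succ k.succ
    simpa [Fin.sum_univ_succ, hc] using this
  obtain ⟨Z, hZ, hPZ⟩ := ih _ hX'
  have hZr := rational_row_mul hZ
  refine ⟨Matrix.of fun i j => Fin.cases (Fin.cases 1 (fun _ => 0) j)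
    (fun i => Fin.cases 0 (Z i) j) i, mul_transpose_eq_one_of_row_mul fun i k => ?_,
    fun i j => ?_⟩
  · cases i using Fin.cases with
    | zero => cases k using Fin.cases <;> simp [Fin.sum_univ_succ, (Fin.succ_ne_zero _).symm]
    | succ i =>
      cases k using Fin.cases with
      | zero => simp [Fin.sum_univ_succ]
      | succ k => simpa [Fin.sum_univ_succ] using hZr i k
  · cases i using Fin.cases with
    | zero => rw [h0]; cases j using Fin.cases <;> simp
    | succ i =>
      cases j using Fin.cases with
      | zero => rw [hP, hc]; simp
      | succ j => simpa using hPZ i j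

/-- A pattern whose first row is supported on exactly the first two columns reduces to a smaller
one: the two columns are proportional below the first row and can be merged. -/
theorem IsRationalPattern.of_first_row_pair {m : ℕ}
    (ih : ∀ P : Matrix (Fin (m + 1)) (Fin (m + 1)) Bool, IsUnitaryPattern P → IsRationalPattern P)
    {P : Matrix (Fin (m + 2)) (Fin (m + 2)) Bool} (hU : IsUnitaryPattern P)
    (h0 : ∀ j, P 0 j = true ↔ j = 0 ∨ j = 1) : IsRationalPattern P := by
  obtain ⟨X, hX, hP⟩ := hU
  have hrow := unitary_row_mul hX
  have hz : ∀ j : Fin m, X 0 j.succ.succ = 0 := fun j => by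
    by_contra h
    rcases (h0 _).1 ((hP _ _).2 h) with h | h
    · exact Fin.succ_ne_zero _ h
    · rw [← Fin.succ_zero_eq_one] at h
      exact Fin.succ_ne_zero _ (Fin.succ_injective _ h)
  have ha : X 0 0 ≠ 0 := (hP 0 0).1 ((h0 0).2 (Or.inl rfl))
  have hb : X 0 1 ≠ 0 := (hP 0 1).1 ((h0 1).2 (Or.inr rfl))
  set a := X 0 0 with ha'
  set b := X 0 1 with hb'
  have hab : a * star a + b * star b = 1 := by
    simpa [Fin.sum_univ_succ, hz] using hrow 0 0
  have hort : ∀ i : Fin (m + 1), X i.succ 0 * star a + X i.succ 1 * star b = 0 := fun i => by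
    simpa [Fin.sum_univ_succ, hz, ← ha', ← hb'] using hrow i.succ 0
  -- Each lower row, cut to the first two columns, is orthogonal to the unit vector `(a, b)`, hence
  -- a multiple `t i` of `(-star b, star a)`. The vector `t` becomes the merged column.
  set t : Fin (m + 1) → ℂ := fun i => X i.succ 1 * a - X i.succ 0 * b with ht
  have hx0 : ∀ i, X i.succ 0 = - (t i * star b) := fun i => by
    simp only [ht]
    linear_combination a * hort i - X i.succ 0 * hab
  have hx1 : ∀ i, X i.succ 1 = t i * star a := fun i => by
    simp only [ht]
    linear_combination b * hort i - X i.succ 1 * hab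
  have hP0 : ∀ i : Fin (m + 1), P i.succ 0 = true ↔ t i ≠ 0 := fun i => by
    rw [hP, hx0]; simp [hb]
  have hP1 : ∀ i : Fin (m + 1), P i.succ 1 = true ↔ t i ≠ 0 := fun i => by
    rw [hP, hx1]; simp [ha]
  have hX' : IsUnitaryPattern (P.submatrix Fin.succ Fin.succ) := by
    refine ⟨Matrix.of fun i j => Fin.cases (t i) (fun j => X i.succ j.succ.succ) j,
      mem_unitaryGroup_of_row_mul fun i k => ?_, fun i j => ?_⟩
    · have h := hrow i.succ k.succ
      rw [Fin.sum_univ_succ, Fin.sum_univ_succ, Fin.succ_zero_eq_one, hx0, hx0, hx1, hx1] at h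
      rw [Fin.sum_univ_succ]
      simp only [Fin.succ_inj] at h
      rw [← h]
      simp only [Matrix.of_apply, Fin.cases_zero, Fin.cases_succ, star_neg, star_mul', star_star]
      linear_combination (- t i * star (t k)) * hab
    · cases j using Fin.cases with
      | zero => simpa using hP1 i
      | succ j => simpa using hP i.succ j.succ.succ
  obtain ⟨Z, hZ, hPZ⟩ := ih _ hX'
  have hZr := rational_row_mul hZ
  -- The merged column is split again along `(-4/5, 3/5)`, orthogonal to the new first row `(3/5,
  -- 4/5)`; the Pythagorean triple gives a rational unit vector with no zero entry.
  refine ⟨Matrix.of fun i j => Fin.cases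
    (Fin.cases (3 / 5) (fun j => Fin.cases (4 / 5) (fun _ => 0) j) j)
    (fun i => Fin.cases (- (4 / 5) * Z i 0)
      (fun j => Fin.cases (3 / 5 * Z i 0) (fun j => Z i j.succ) j) j) i,
    mul_transpose_eq_one_of_row_mul fun i k => ?_, fun i j => ?_⟩
  · cases i using Fin.cases with
    | zero =>
      cases k using Fin.cases with
      | zero => simp [Fin.sum_univ_succ]; norm_num
      | succ k => simp [Fin.sum_univ_succ, (Fin.succ_ne_zero _).symm]; ring
    | succ i =>
      cases k using Fin.cases with
      | zero => simp [Fin.sum_univ_succ]; ring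
      | succ k =>
        have h := hZr i k
        rw [Fin.sum_univ_succ] at h
        rw [Fin.sum_univ_succ, Fin.sum_univ_succ]
        simp only [Matrix.of_apply, Fin.cases_zero, Fin.cases_succ, Fin.succ_inj]
        rw [← h]
        ring
  · have h1 := fun i => hPZ i 0
    simp only [Matrix.submatrix_apply, Fin.succ_zero_eq_one] at h1
    cases i using Fin.cases with
    | zero =>
      rw [h0]
      cases j using Fin.cases with
      | zero => simp
      | succ j =>
        cases j using Fin.cases with
        | zero =>
          change _ ↔ (4 / 5 : ℚ) ≠ 0
          simp
        | succ j =>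
          simp only [Fin.succ_ne_zero, false_or, Matrix.of_apply, Fin.cases_zero, Fin.cases_succ,
            ne_eq, not_true_eq_false, iff_false]
          rw [← Fin.succ_zero_eq_one, Fin.succ_inj]
          exact Fin.succ_ne_zero _
    | succ i =>
      cases j using Fin.cases with
      | zero => rw [hP0, ← hP1, h1]; simp
      | succ j =>
        cases j using Fin.cases with
        | zero =>
          rw [Fin.succ_zero_eq_one, h1]
          change _ ↔ 3 / 5 * Z i 0 ≠ 0
          simp
        | succ j => simpa using hPZ i j.succ

theorem exists_perm_zero_one {m : ℕ} {p q : Fin (m + 2)} (h : p ≠ q) :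
    ∃ τ : Equiv.Perm (Fin (m + 2)), τ 0 = p ∧ τ 1 = q := by
  refine ⟨Equiv.swap 0 p * Equiv.swap 1 (Equiv.swap 0 p q), ?_, by simp⟩
  have : Equiv.swap 0 p q ≠ 0 := fun h' => h (by
    rw [Equiv.swap_apply_eq_iff, Equiv.swap_apply_left] at h'; exact h'.symm)
  rw [Equiv.Perm.mul_apply, Equiv.swap_apply_of_ne_of_ne (by simp) this.symm,
    Equiv.swap_apply_left]

/-- A row of weight at most two allows a reduction to a smaller pattern. -/
theorem IsRationalPattern.of_row_card_le_two {m : ℕ}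
    (ih : ∀ P : Matrix (Fin m) (Fin m) Bool, IsUnitaryPattern P → IsRationalPattern P)
    {P : Matrix (Fin (m + 1)) (Fin (m + 1)) Bool} (hU : IsUnitaryPattern P) {i : Fin (m + 1)}
    (hi : (Finset.univ.filter fun j => P i j = true).card ≤ 2) : IsRationalPattern P := by
  have h0 : (Finset.univ.filter fun j => P i j = true).card ≠ 0 := fun h => by
    obtain ⟨X, hX, hP⟩ := hU
    have h1 := unitary_row_mul hX i i
    rw [Finset.card_eq_zero, Finset.filter_eq_empty_iff] at h
    rw [Finset.sum_eq_zero] at h1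
    · simp at h1
    · intro j _
      have : X i j = 0 := by
        by_contra hne
        exact h (Finset.mem_univ j) ((hP _ _).2 hne)
      simp [this]
  have h12 : (Finset.univ.filter fun j => P i j = true).card = 1 ∨
      (Finset.univ.filter fun j => P i j = true).card = 2 := by omega
  rcases h12 with h | h
  · obtain ⟨p, hp⟩ := Finset.card_eq_one.1 h
    refine IsRationalPattern.of_submatrix (σ := Equiv.swap 0 i) (τ := Equiv.swap 0 p)
      (IsRationalPattern.of_first_row_single ih (hU.submatrix _ _) fun j => ?_)
    have : Equiv.swap 0 p j ∈ (Finset.univ.filter fun j => P i j = true) ↔ j = 0 := by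
      rw [hp, Finset.mem_singleton, Equiv.swap_apply_eq_iff, Equiv.swap_apply_right]
    simpa using this
  · obtain ⟨p, q, hpq, hs⟩ := Finset.card_eq_two.1 h
    cases m with
    | zero => exact absurd (Fin.ext (by omega)) hpq
    | succ m =>
      obtain ⟨τ, h0, h1⟩ := exists_perm_zero_one hpq
      refine IsRationalPattern.of_submatrix (σ := Equiv.swap 0 i) (τ := τ)
        (IsRationalPattern.of_first_row_pair ih (hU.submatrix _ _) fun j => ?_)
      have : τ j ∈ (Finset.univ.filter fun j => P i j = true) ↔ j = 0 ∨ j = 1 := by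
        rw [hs, Finset.mem_insert, Finset.mem_singleton, ← h0, ← h1, τ.injective.eq_iff,
          τ.injective.eq_iff]
      simpa using this

/-! ### Orthogonality on a small set of columns -/

/-- There are at most `T.card` vectors that are nonzero and pairwise orthogonal on `T`. -/
theorem card_le_of_orthogonal_on {κ ι : Type*} [Fintype κ] [LinearOrder κ] (v : κ → ι → ℂ)
    (T : Finset ι) (hne : ∀ a, ∃ j ∈ T, v a j ≠ 0)
    (horth : ∀ a b, a < b → ∑ j ∈ T, v a j * star (v b j) = 0) : Fintype.card κ ≤ T.card := by
  have hsymm : ∀ a b, a ≠ b → ∑ j ∈ T, v a j * star (v b j) = 0 := fun a b hab => by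
    rcases lt_or_gt_of_ne hab with h | h
    · exact horth a b h
    · have := congrArg star (horth b a h)
      simpa [star_sum, mul_comm] using this
  let w : κ → EuclideanSpace ℂ T := fun a => WithLp.toLp 2 fun j => v a j
  have hw : LinearIndependent ℂ w := by
    refine linearIndependent_of_ne_zero_of_inner_eq_zero (fun a ha => ?_) fun a b hab => ?_
    · obtain ⟨j, hj, hv⟩ := hne a
      exact hv (congrFun (congrArg WithLp.ofLp ha) ⟨j, hj⟩)
    · have := hsymm b a hab.symm
      rw [← Finset.sum_coe_sort] at this
      simpa [w, PiLp.inner_apply, mul_comm] using this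
  simpa using hw.fintype_card_le_finrank

theorem sum_row_mul_on {n : ℕ} {X : Matrix (Fin n) (Fin n) ℂ}
    (hX : X ∈ Matrix.unitaryGroup (Fin n) ℂ) {i k : Fin n} (hik : i ≠ k) {T : Finset (Fin n)}
    (hT : ∀ j, X i j ≠ 0 → X k j ≠ 0 → j ∈ T) : ∑ j ∈ T, X i j * star (X k j) = 0 := by
  have h := unitary_row_mul hX i k
  rw [if_neg hik] at h
  rw [← h]
  refine Finset.sum_subset (Finset.subset_univ _) fun j _ hj => ?_
  by_contra hne
  exact hj (hT j (left_ne_zero_of_mul hne) (star_ne_zero.1 (right_ne_zero_of_mul hne)))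

/-- If the rows `f a` of a unitary matrix overlap only in the columns in `T`, and all of them meet
`T`, then there are at most `T.card` of them. -/
theorem card_le_of_overlap {n : ℕ} {X : Matrix (Fin n) (Fin n) ℂ}
    (hX : X ∈ Matrix.unitaryGroup (Fin n) ℂ) {κ : Type*} [Fintype κ] [LinearOrder κ]
    (f : κ → Fin n) (T : Finset (Fin n)) (hne : ∀ a, ∃ j ∈ T, X (f a) j ≠ 0)
    (hT : ∀ a b, a < b → f a ≠ f b ∧ ∀ j, X (f a) j ≠ 0 → X (f b) j ≠ 0 → j ∈ T) :
    Fintype.card κ ≤ T.card :=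
  card_le_of_orthogonal_on (fun a => X (f a)) T hne fun a b hab =>
    sum_row_mul_on hX (hT a b hab).1 (hT a b hab).2

/-- If two rows of a unitary matrix have the same support `T` of size three and a third row `s`
meets `T` without containing the column `j` of `T`, then all further rows vanish in column `j`. -/
theorem eq_zero_of_equal_supports {n : ℕ} {X : Matrix (Fin n) (Fin n) ℂ}
    (hX : X ∈ Matrix.unitaryGroup (Fin n) ℂ) {a b s t : Fin n} (hab : a ≠ b) (has : a ≠ s)
    (hbs : b ≠ s) (hat : a ≠ t) (hbt : b ≠ t) {T : Finset (Fin n)} (hT : T.card = 3)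
    (ha : ∀ j, j ∈ T ↔ X a j ≠ 0) (hb : ∀ j, j ∈ T ↔ X b j ≠ 0)
    (hs : ∃ j ∈ T, X s j ≠ 0) {j : Fin n} (hj : j ∈ T) (hsj : X s j = 0) : X t j = 0 := by
  by_contra htj
  have oa : ∀ k, a ≠ k → ∑ j ∈ T, X a j * star (X k j) = 0 := fun k hk =>
    sum_row_mul_on hX hk fun j h _ => (ha j).2 h
  have ob : ∀ k, b ≠ k → ∑ j ∈ T, X b j * star (X k j) = 0 := fun k hk =>
    sum_row_mul_on hX hk fun j h _ => (hb j).2 h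
  set N : ℂ := ∑ j ∈ T, X s j * star (X s j) with hN
  have hN0 : N ≠ 0 := by
    obtain ⟨i, hi, hsi⟩ := hs
    have hN' : N = ((∑ j ∈ T, Complex.normSq (X s j) : ℝ) : ℂ) := by
      rw [hN, Complex.ofReal_sum]
      exact Finset.sum_congr rfl fun j _ => Complex.mul_conj _
    rw [hN', Complex.ofReal_ne_zero]
    exact (Finset.sum_pos' (fun j _ => Complex.normSq_nonneg _)
      ⟨i, hi, Complex.normSq_pos.2 hsi⟩).ne'
  -- On `T` the rows `a`, `b`, `s` are orthogonal and nonzero. Subtracting from row `t` its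
  -- projection onto row `s` leaves a vector orthogonal to all three; it keeps the nonzero entry at
  -- `j` because `X s j = 0`. Four such vectors do not fit in dimension three.
  set c : ℂ := (∑ j ∈ T, X s j * star (X t j)) / N with hc
  have key := card_le_of_orthogonal_on
    ![X a, X b, X s, fun j => X t j - star c * X s j] T (fun i => ?_) fun i k hik => ?_
  · rw [hT] at key
    simp at key
  · fin_cases i
    · exact ⟨j, hj, (ha j).1 hj⟩
    · exact ⟨j, hj, (hb j).1 hj⟩
    · exact hs
    · exact ⟨j, hj, by simpa [hsj] using htj⟩
  · have expand : ∀ u : Fin n → ℂ, ∑ j ∈ T, u j * star (X t j - star c * X s j) =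
        ∑ j ∈ T, u j * star (X t j) - c * ∑ j ∈ T, u j * star (X s j) := fun u => by
      rw [Finset.mul_sum, ← Finset.sum_sub_distrib]
      refine Finset.sum_congr rfl fun j _ => ?_
      rw [star_sub, star_mul', star_star]
      ring
    fin_cases i <;> fin_cases k <;> first | exact absurd hik (by decide) | skip
    · exact oa b hab
    · exact oa s has
    · exact (expand (X a)).trans (by rw [oa t hat, oa s has]; ring)
    · exact ob s hbs
    · exact (expand (X b)).trans (by rw [ob t hbt, ob s hbs]; ring)
    · refine (expand (X s)).trans ?_
      change _ - c * N = 0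
      rw [hc, div_mul_cancel₀ _ hN0, sub_self]

/-! ### Combinatorial constraints on reduced patterns -/

/-- A unitary pattern all of whose rows and columns have at least three entries. -/
structure IsReducedPattern {n : ℕ} (P : Matrix (Fin n) (Fin n) Bool) : Prop where
  unitary : IsUnitaryPattern P
  row : ∀ i, 3 ≤ (Finset.univ.filter fun j => P i j = true).card
  col : ∀ j, 3 ≤ (Finset.univ.filter fun i => P i j = true).card

namespace IsReducedPattern

variable {n : ℕ} {P : Matrix (Fin n) (Fin n) Bool}

theorem transpose (h : IsReducedPattern P) : IsReducedPattern Pᵀ :=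
  ⟨h.unitary.transpose, h.col, h.row⟩

theorem submatrix (h : IsReducedPattern P) (σ τ : Equiv.Perm (Fin n)) :
    IsReducedPattern (P.submatrix σ τ) := by
  refine ⟨h.unitary.submatrix σ τ, fun i => ?_, fun j => ?_⟩
  · have : (Finset.univ.filter fun j => P.submatrix σ τ i j = true).card =
        (Finset.univ.filter fun j => P (σ i) j = true).card :=
      Finset.card_bijective τ τ.bijective fun j => by
        rw [Finset.mem_filter_univ, Finset.mem_filter_univ, Matrix.submatrix_apply]
    exact this ▸ h.row (σ i)
  · have : (Finset.univ.filter fun i => P.submatrix σ τ i j = true).card =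
        (Finset.univ.filter fun i => P i (τ j) = true).card :=
      Finset.card_bijective σ σ.bijective fun i => by
        rw [Finset.mem_filter_univ, Finset.mem_filter_univ, Matrix.submatrix_apply]
    exact this ▸ h.col (τ j)

/-- Any two rows meet when `n ≤ 5`. -/
theorem exists_common (h : IsReducedPattern P) (hn : n ≤ 5) (i k : Fin n) :
    ∃ j, P i j = true ∧ P k j = true := by
  by_contra! hne
  have hd : Disjoint (Finset.univ.filter fun j => P i j = true)
      (Finset.univ.filter fun j => P k j = true) := by
    rw [Finset.disjoint_filter]
    exact fun j _ => hne j
  have h1 := Finset.card_le_univ ((Finset.univ.filter fun j => P i j = true) ∪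
    (Finset.univ.filter fun j => P k j = true))
  rw [Finset.card_union_of_disjoint hd, Fintype.card_fin] at h1
  have := h.row i
  have := h.row k
  omega

/-- With a single common column, the inner product of two distinct rows would be a single nonzero
term. -/
theorem card_common_ne_one (h : IsReducedPattern P) (i k : Fin n) :
    (Finset.univ.filter fun j => (P i j && P k j) = true).card ≠ 1 := by
  intro h1
  by_cases hik : i = k
  · subst hik
    have := h.row i
    simp only [Bool.and_self] at h1
    omega
  obtain ⟨X, hX, hP⟩ := h.unitary
  set T := Finset.univ.filter fun j => (P i j && P k j) = true with hT
  obtain ⟨j, hj⟩ : T.Nonempty := Finset.card_pos.1 (by omega)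
  have hj' : P i j = true ∧ P k j = true := by simpa [hT] using hj
  have := card_le_of_overlap hX ![i, k] T (fun a => ⟨j, hj, by
    fin_cases a
    · exact (hP _ _).1 hj'.1
    · exact (hP _ _).1 hj'.2⟩) (fun a b hab => by
    fin_cases a <;> fin_cases b <;> first | exact absurd hab (by decide) | skip
    exact ⟨hik, fun j h1 h2 => by
      simpa [hT] using And.intro ((hP _ _).2 h1) ((hP _ _).2 h2)⟩)
  simp at this
  omega

/-- Three distinct rows overlap pairwise only inside the set `T` of columns met by at least two of
them, so their restrictions to `T` are orthogonal; these are nonzero because any two rows meet.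
Coinciding indices are allowed, since `admissible` quantifies over codes with repetition; then `T`
contains a whole row. -/
theorem two_lt_card_majority (h : IsReducedPattern P) (hn : n ≤ 5) (i k l : Fin n) :
    2 < (Finset.univ.filter fun j =>
      ((P i j && P k j) || (P i j && P l j) || (P k j && P l j)) = true).card := by
  set T := Finset.univ.filter fun j =>
    ((P i j && P k j) || (P i j && P l j) || (P k j && P l j)) = true with hT
  have hmem : ∀ j, j ∈ T ↔ (P i j = true ∧ P k j = true) ∨ (P i j = true ∧ P l j = true) ∨
      (P k j = true ∧ P l j = true) := fun j => by simp [hT, or_assoc]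
  have hsub : ∀ i', (∀ j, P i' j = true → j ∈ T) → 2 < T.card := fun i' h' =>
    lt_of_lt_of_le (h.row i') (Finset.card_le_card fun j hj => h' j (by simpa using hj))
  by_cases hik : i = k
  · exact hsub i fun j hj => (hmem j).2 (Or.inl ⟨hj, hik ▸ hj⟩)
  by_cases hil : i = l
  · exact hsub i fun j hj => (hmem j).2 (Or.inr (Or.inl ⟨hj, hil ▸ hj⟩))
  by_cases hkl : k = l
  · exact hsub k fun j hj => (hmem j).2 (Or.inr (Or.inr ⟨hj, hkl ▸ hj⟩))
  obtain ⟨X, hX, hP⟩ := h.unitary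
  obtain ⟨p, hp1, hp2⟩ := h.exists_common hn i k
  obtain ⟨q, hq1, hq2⟩ := h.exists_common hn i l
  have hp := (hmem p).2 (Or.inl ⟨hp1, hp2⟩)
  have hq := (hmem q).2 (Or.inr (Or.inl ⟨hq1, hq2⟩))
  have := card_le_of_overlap hX ![i, k, l] T (fun a => by
    fin_cases a
    · exact ⟨p, hp, (hP _ _).1 hp1⟩
    · exact ⟨p, hp, (hP _ _).1 hp2⟩
    · exact ⟨q, hq, (hP _ _).1 hq2⟩) (fun a b hab => by
    fin_cases a <;> fin_cases b <;> first | exact absurd hab (by decide) | skip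
    · exact ⟨hik, fun j h1 h2 => (hmem j).2 (Or.inl ⟨(hP _ _).2 h1, (hP _ _).2 h2⟩)⟩
    · exact ⟨hil, fun j h1 h2 => (hmem j).2 (Or.inr (Or.inl ⟨(hP _ _).2 h1, (hP _ _).2 h2⟩))⟩
    · exact ⟨hkl, fun j h1 h2 => (hmem j).2 (Or.inr (Or.inr ⟨(hP _ _).2 h1, (hP _ _).2 h2⟩))⟩)
  simp at this
  omega

/-- If row `s` missed the column `j`, then `eq_zero_of_equal_supports` would empty that column
outside rows `a` and `b`, leaving it fewer than three entries. -/
theorem le_of_equal_rows (h : IsReducedPattern P) (hn : n ≤ 5) {a b : Fin n} (hab : a ≠ b)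
    (heq : P a = P b) (h3 : (Finset.univ.filter fun j => P a j = true).card = 3) (s j : Fin n)
    (hj : P a j = true) : P s j = true := by
  by_contra hsj
  have has : a ≠ s := fun h' => hsj (h' ▸ hj)
  have hbs : b ≠ s := fun h' => hsj (h' ▸ heq ▸ hj)
  obtain ⟨X, hX, hP⟩ := h.unitary
  have hcol : ∃ t, t ∉ ({a, b} : Finset (Fin n)) ∧ P t j = true := by
    by_contra! hne
    have h1 : (Finset.univ.filter fun i => P i j = true) ⊆ {a, b} := fun t ht => by
      by_contra ht'
      exact hne t ht' (by simpa using ht)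
    have := (h.col j).trans ((Finset.card_le_card h1).trans Finset.card_le_two)
    omega
  obtain ⟨t, ht, htj⟩ := hcol
  simp only [Finset.mem_insert, Finset.mem_singleton, not_or] at ht
  obtain ⟨p, hp1, hp2⟩ := h.exists_common hn a s
  refine (hP t j).1 htj (eq_zero_of_equal_supports hX hab has hbs (Ne.symm ht.1) (Ne.symm ht.2) h3
    (fun j => by simp [hP]) (fun j => by rw [heq]; simp [hP])
    ⟨p, by simpa using hp1, (hP _ _).1 hp2⟩ (by simpa using hj) ?_)
  by_contra hne
  exact hsj ((hP _ _).2 hne)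

end IsReducedPattern

/-! ### The search, on binary codes of rows -/

/-- The number of ones among the `n` lowest binary digits of `m`. -/
def bitWeight : ℕ → ℕ → ℕ
  | 0, _ => 0
  | n + 1, m => m % 2 + bitWeight n (m / 2)

/-- The number whose binary digits are the digits of `m` at the positions in `p`. -/
def permuteBits (p : List ℕ) (m : ℕ) : ℕ :=
  p.foldr (fun i v => 2 * v + (m.testBit i).toNat) 0

/-- The binary codes of the columns of the matrix whose rows have the codes in `l`. -/
def transposeCodes (n : ℕ) (l : List ℕ) : List ℕ :=
  (List.range n).map fun j => l.foldr (fun m v => 2 * v + (m.testBit j).toNat) 0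

/-- Conditions met by the row codes in any submatrix of a reduced unitary pattern. -/
def admissible (n : ℕ) (l : List ℕ) : Bool :=
  -- All four conditions pass from a full list of rows to its sublists, so partial lists can be
  -- pruned. The last one counts zeros rather than ones in a column for this reason.
  (l.all fun r => l.all fun q => bitWeight n (r &&& q) != 1) &&
  (l.all fun r => l.all fun q => l.all fun s =>
    2 < bitWeight n ((r &&& q) ||| (r &&& s) ||| (q &&& s))) &&
  (l.all fun q => bitWeight n q != 3 || l.count q < 2 || l.all fun s => s &&& q == q) &&
  ((List.range n).all fun j => l.countP (fun r => !r.testBit j) + 3 ≤ n)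

/-- The permutations of the column positions. -/
def columnPerms (n : ℕ) : List (List ℕ) := (List.range n).permutations'

/-- The increasing rearrangement of a list of row codes. -/
def sortCodes (l : List ℕ) : List ℕ := l.insertionSort (· ≤ ·)

/-- Whether the column counts of `l` increase along the positions in `p`. -/
def sortsColumns (l : List ℕ) : List ℕ → Bool
  | i :: j :: p => ((l.countP fun r => r.testBit i).ble (l.countP fun r => r.testBit j)) &&
      sortsColumns l (j :: p)
  | _ => true

/-- The images of `l` under the column permutations that sort the column counts. -/
def normalForms (n : ℕ) (l : List ℕ) : List (List ℕ) :=
  ((columnPerms n).filter (sortsColumns l)).map fun p => sortCodes (l.map (permuteBits p))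

/-- Adds the first of the given forms to `L` unless one of them is there. -/
def addClass (L : List (List ℕ)) : List (List ℕ) → List (List ℕ)
  | [] => L
  | l :: ls => if (l :: ls).any fun b => L.elem b then L else l :: L

/-- Adds forms of the admissible lists among the given ones to `L`. -/
def classes (n : ℕ) : List (List ℕ) → List (List ℕ) → List (List ℕ)
  | [], L => L
  -- Appending `l` itself makes the list of forms visibly nonempty, so no proof is needed that some
  -- permutation sorts the columns.
  | l :: ls, L => classes n ls (if admissible n l then addClass L (normalForms n l ++ [l]) else L)

/-- The codes of the rows with at least three entries. -/
def rowCandidates (n : ℕ) : List ℕ := (List.range (2 ^ n)).filter fun m => 3 ≤ bitWeight n m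

/-- Representatives of the admissible lists of `k` row codes up to permutations. -/
def level (n : ℕ) : ℕ → List (List ℕ)
  | 0 => [[]]
  | k + 1 => classes n ((level n k).flatMap fun l => (rowCandidates n).map (· :: l)) []

/-- The binary codes of the rows of a pattern. -/
def rowCodes {n : ℕ} (P : Matrix (Fin n) (Fin n) Bool) : List ℕ :=
  List.ofFn fun i => Nat.ofBits (P i)

/-- The pattern of the nonzero entries of an integer matrix. -/
def intPattern {n : ℕ} (M : Matrix (Fin n) (Fin n) ℤ) : Matrix (Fin n) (Fin n) Bool :=
  M.map fun x => x != 0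

/-- Whether every reduced unitary pattern of size `n` is, up to permutations and transposition, the
pattern of a matrix in the table. -/
def tableCovers (n : ℕ) (t : List (ℤ × Matrix (Fin n) (Fin n) ℤ)) : Bool :=
  let codes := t.flatMap fun M =>
    [sortCodes (rowCodes (intPattern M.2)), sortCodes (rowCodes (intPattern M.2ᵀ))]
  (level n n).all fun b => !admissible n (transposeCodes n b) ||
    (columnPerms n).any fun p => codes.elem (sortCodes (b.map (permuteBits p)))

/-! ### Tables of scaled rational orthogonal matrices -/

/-- Integer matrices of size three of the form `d • Q` with `Q` orthogonal, paired with `d`. -/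
def orthogonalTable3 : List (ℤ × Matrix (Fin 3) (Fin 3) ℤ) :=
  [(3, !![1, 2, 2; 2, 1, -2; 2, -2, 1])]

/-- Integer matrices of size four of the form `d • Q` with `Q` orthogonal, paired with `d`. -/
def orthogonalTable4 : List (ℤ × Matrix (Fin 4) (Fin 4) ℤ) :=
  [(2, !![1, 1, 1, 1; 1, -1, -1, 1; 1, -1, 1, -1; 1, 1, -1, -1]),
   (9, !![0, 3, 6, 6; 3, -8, 2, 2; 6, 2, -5, 4; 6, 2, 4, -5]),
   (9, !![0, 1, 4, 8; 6, 0, -6, 3; 3, 8, 2, -2; 6, -4, 5, -2]),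
   (33, !![0, 1, 32, 8; 16, 0, -7, 28; 7, 32, 0, -4; 28, -8, 4, -15]),
   (3, !![0, 1, 2, 2; 1, 0, -2, 2; 2, 2, 0, -1; 2, -2, 1, 0])]

/-- Integer matrices of size five of the form `d • Q` with `Q` orthogonal, paired with `d`. -/
def orthogonalTable5 : List (ℤ × Matrix (Fin 5) (Fin 5) ℤ) :=
  [(5, !![2, 2, 3, 2, 2; 3, -2, 2, -2, -2; 2, 2, -2, 2, -3; 2, -3, -2, 2, 2; 2, 2, -2, -3, 2]),
   (4, !![0, 2, 2, 2, 2; 2, 1, 1, -3, 1; 2, 1, -3, 1, 1; 2, 1, 1, 1, -3; 2, -3, 1, 1, 1]),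
   (7, !![0, 1, 4, 4, 4; 5, 0, -4, 2, 2; 2, -4, 2, -4, 3; 2, -4, 2, 3, -4; 4, 4, 3, -2, -2]),
   (11, !![0, 0, 6, 9, 2; 1, 2, 8, -4, -6; 10, -2, -2, 2, -3; 4, 8, 1, -2, 6; 2, -7, 4, -4, 6]),
   (9, !![0, 0, 6, 3, 6; 0, 8, -2, -2, 3; 6, -3, -2, -4, 4; 6, 2, -1, 6, -2; 3, 2, 6, -4, -4]),
   (11, !![0, 5, 4, 4, 8; 1, 0, 10, -2, -4; 10, -4, 0, 1, 2; 4, 8, -2, -6, -1; 2, 4, -1, 8, -6]),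
   (13, !![0, 0, 4, 12, 3; 10, -1, 0, 2, -8; 2, -8, -9, 2, 4; 4, 10, -6, 1, 4; 7, -2, 6, -4, 8]),
   (5, !![2, 2, 2, 2, 3; 0, 4, -2, 1, -2; 4, 0, 1, -2, -2; 1, -2, 0, 4, -2; 2, -1, -4, 0, 2]),
   (6, !![0, 0, 2, 4, 4; 5, -3, 0, 1, -1; 3, 3, 0, -3, 3; 1, 3, 4, 1, -3; 1, 3, -4, 3, -1]),
   (9, !![0, 0, 3, 6, 6; 0, 0, 6, -6, 3; 3, 6, 4, 2, -4; 6, -6, 2, 1, -2; 6, 3, -4, -2, 4]),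
   (9, !![0, 0, 6, 6, 3; 0, 4, 5, -2, -6; 6, -5, 0, 2, -4; 3, -2, 4, -6, 4; 6, 6, -2, 1, 2]),
   (15, !![0, 0, 10, 5, 10; 6, -12, 0, -6, 3; 12, 7, -4, 0, 4; 3, 4, 10, -8, -6; 6, -4, 3, 10, -8]),
   (21, !![0, 0, 14, 7, 14; 0, 14, 0, 14, -7;
     6, -9, -12, 12, 6; 9, -10, 10, 4, -12; 18, 8, -1, -6, 4]),
   (9, !![0, 0, 6, 6, 3; 0, 6, 0, 3, -6; 6, 0, -5, 4, 2; 3, 6, 2, -4, 4; 6, -3, 4, -2, -4]),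
   (21, !![0, 0, 6, 18, 9; 0, 14, 0, -7, 14; 13, -8, -12, 0, 8; 4, -10, 15, -8, 6;
     16, 9, 6, 2, -8]),
   (21, !![0, 0, 18, 6, 9; 10, -4, 0, -15, 10; 17, 10, 0, 6, -4; 6, -15, 6, 0, -12;
     4, -10, -9, 12, 10]),
   (27, !![0, 0, 24, 3, 12; 0, 18, -7, 16, 10; 25, -6, 0, 8, -2; 2, 15, 10, 0, -20;
     10, 12, -2, -20, 9]),
   (33, !![0, 0, 22, 22, 11; 12, -30, 0, 3, -6; 12, 10, 13, 0, -26; 15, 8, -20, 20, 0;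
     24, 5, 6, -14, 16]),
   (105, !![0, 25, 20, 80, 60; 80, 0, -50, -19, 42; 50, -20, 0, 58, -69;
     3, -96, 30, 0, 30; 46, 28, 85, -30, 0]),
   (9, !![0, 0, 6, 3, 6; 0, 1, 0, 8, -4; 6, 0, -5, 2, 4; 3, -8, 2, 0, -2; 6, 4, 4, -2, -3]),
   (15, !![0, 0, 10, 5, 10; 12, -6, 0, -6, 3; 1, 12, 0, -8, 4; 4, 3, 10, 0, -10; 8, 6, -5, 10, 0]),
   (21, !![0, 0, 6, 9, 18; 0, 14, 0, -14, 7; 20, 1, 6, 0, -2; 4, 10, -15, 10, 0;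
     5, -12, -12, -8, 8]),
   (21, !![0, 0, 20, 5, 4; 0, 7, 6, -16, -10; 6, -6, 0, -12, 15; 9, -16, 2, 0, -10;
     18, 10, -1, 4, 0]),
   (273, !![0, 0, 84, 63, 252; 0, 52, 0, -260, 65; 169, 0, -204, 16, 64;
     -208, -65, -156, 0, 52; -52, 260, -39, 52, 0])]

theorem orthogonalTable3_spec :
    ∀ M ∈ orthogonalTable3, M.1 ≠ 0 ∧ M.2 * M.2ᵀ = M.1 ^ 2 • (1 : Matrix (Fin 3) (Fin 3) ℤ) := by
  decide +kernel

theorem orthogonalTable4_spec :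
    ∀ M ∈ orthogonalTable4, M.1 ≠ 0 ∧ M.2 * M.2ᵀ = M.1 ^ 2 • (1 : Matrix (Fin 4) (Fin 4) ℤ) := by
  decide +kernel

theorem orthogonalTable5_spec :
    ∀ M ∈ orthogonalTable5, M.1 ≠ 0 ∧ M.2 * M.2ᵀ = M.1 ^ 2 • (1 : Matrix (Fin 5) (Fin 5) ℤ) := by
  decide +kernel

theorem tableCovers_three : tableCovers 3 orthogonalTable3 = true := by decide +kernel

theorem tableCovers_four : tableCovers 4 orthogonalTable4 = true := by decide +kernel

theorem tableCovers_five : tableCovers 5 orthogonalTable5 = true := by decide +kernel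

/-! ### Completeness of the search -/

theorem bitWeight_ofBits {n : ℕ} (f : Fin n → Bool) :
    bitWeight n (Nat.ofBits f) = (Finset.univ.filter fun j => f j = true).card := by
  rw [Finset.card_filter]
  induction n with
  | zero => rfl
  | succ n ih =>
    have h2 : (2 * Nat.ofBits (f ∘ Fin.succ) + (f 0).toNat) / 2 = Nat.ofBits (f ∘ Fin.succ) := by
      cases f 0 <;> simp; omega
    have h1 : (2 * Nat.ofBits (f ∘ Fin.succ) + (f 0).toNat) % 2 = if f 0 = true then 1 else 0 := by
      cases f 0 <;> simp
    rw [Nat.ofBits_succ, bitWeight, h1, h2, ih, Fin.sum_univ_succ]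
    rfl

theorem ofBits_injective {n : ℕ} {f g : Fin n → Bool} (h : Nat.ofBits f = Nat.ofBits g) :
    f = g := by
  funext i
  rw [← Nat.testBit_ofBits_lt f i i.2, h, Nat.testBit_ofBits_lt g i i.2]

theorem ofBits_land {n : ℕ} (f g : Fin n → Bool) :
    Nat.ofBits f &&& Nat.ofBits g = Nat.ofBits fun j => f j && g j := by
  refine Nat.eq_of_testBit_eq fun i => ?_
  rw [Nat.testBit_land, Nat.testBit_ofBits, Nat.testBit_ofBits, Nat.testBit_ofBits]
  split <;> rfl

theorem ofBits_lor {n : ℕ} (f g : Fin n → Bool) :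
    Nat.ofBits f ||| Nat.ofBits g = Nat.ofBits fun j => f j || g j := by
  refine Nat.eq_of_testBit_eq fun i => ?_
  rw [Nat.testBit_lor, Nat.testBit_ofBits, Nat.testBit_ofBits, Nat.testBit_ofBits]
  split <;> rfl

theorem foldr_ofFn_eq_ofBits {n : ℕ} {α : Type*} (g : Fin n → α) (b : α → Bool) :
    (List.ofFn g).foldr (fun i v => 2 * v + (b i).toNat) 0 = Nat.ofBits fun j => b (g j) := by
  induction n with
  | zero => rfl
  | succ n ih =>
    rw [List.ofFn_succ, List.foldr_cons, ih, Nat.ofBits_succ]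
    rfl

theorem permuteBits_ofBits {n : ℕ} (τ : Fin n → Fin n) (f : Fin n → Bool) :
    permuteBits (List.ofFn fun j => (τ j : ℕ)) (Nat.ofBits f) = Nat.ofBits fun j => f (τ j) := by
  rw [permuteBits, foldr_ofFn_eq_ofBits (fun j => (τ j : ℕ)) fun i => (Nat.ofBits f).testBit i]
  congr 1
  funext j
  exact Nat.testBit_ofBits_lt f _ (τ j).2

theorem countP_ofFn {n : ℕ} {α : Type*} (p : α → Bool) (f : Fin n → α) :
    (List.ofFn f).countP p = (Finset.univ.filter fun i => p (f i) = true).card := by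
  rw [Finset.card_filter]
  induction n with
  | zero => rfl
  | succ n ih =>
    rw [List.ofFn_succ, List.countP_cons, ih, Fin.sum_univ_succ, add_comm]

/-- A rearrangement of a finite family is its composition with a permutation. -/
theorem exists_perm_of_ofFn_perm {n : ℕ} {α : Type*} [DecidableEq α] {l : List α} {f : Fin n → α}
    (h : l.Perm (List.ofFn f)) :
    ∃ σ : Equiv.Perm (Fin n), l = List.ofFn fun i => f (σ i) := by
  have hl : l.length = n := by simpa using h.length_eq
  have hl' : (List.ofFn f).length = n := List.length_ofFn
  let g : Fin n → Fin n := fun i => (h.idxBij (i.cast hl.symm)).cast hl'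
  have hg : Function.Injective g := fun i j hij => by
    have := h.idxBij_injective (Fin.cast_injective hl' hij)
    exact Fin.cast_injective hl.symm this
  refine ⟨Equiv.ofBijective g (Finite.injective_iff_bijective.1 hg), ?_⟩
  refine List.ext_getElem (by simp [hl]) fun i h1 h2 => ?_
  have := h.getElem_idxBij_eq_getElem ⟨i, h1⟩
  rw [List.getElem_ofFn] at this
  rw [List.getElem_ofFn]
  exact this.symm

section rowCodes

variable {n : ℕ} {P Q : Matrix (Fin n) (Fin n) Bool}

theorem mem_rowCodes {m : ℕ} : m ∈ rowCodes P ↔ ∃ i, Nat.ofBits (P i) = m := by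
  rw [rowCodes, List.mem_ofFn']
  rfl

theorem rowCodes_injective (h : rowCodes P = rowCodes Q) : P = Q := by
  have := List.ofFn_injective h
  funext i
  exact ofBits_injective (congrFun this i)

theorem exists_perm_of_mem_columnPerms {p : List ℕ} (hp : p ∈ columnPerms n) :
    ∃ τ : Equiv.Perm (Fin n), p = List.ofFn fun j => (τ j : ℕ) := by
  have hr : List.range n = List.ofFn fun i : Fin n => (i : ℕ) :=
    List.ext_getElem (by simp) fun i _ _ => by simp
  rw [columnPerms, List.mem_permutations', hr] at hp
  exact exists_perm_of_ofFn_perm hp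

theorem map_permuteBits_rowCodes (τ : Equiv.Perm (Fin n)) :
    (rowCodes P).map (permuteBits (List.ofFn fun j => (τ j : ℕ))) =
      rowCodes (P.submatrix id τ) := by
  rw [rowCodes, List.map_ofFn, rowCodes]
  congr 1
  funext i
  exact permuteBits_ofBits τ (P i)

theorem exists_submatrix_of_perm {l : List ℕ} (h : l.Perm (rowCodes P)) :
    ∃ σ : Equiv.Perm (Fin n), l = rowCodes (P.submatrix σ id) :=
  exists_perm_of_ofFn_perm h

theorem transposeCodes_rowCodes : transposeCodes n (rowCodes P) = rowCodes Pᵀ := by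
  refine List.ext_getElem (by simp [transposeCodes, rowCodes]) fun j h1 h2 => ?_
  have hj : j < n := by simpa [rowCodes] using h2
  simp only [transposeCodes, rowCodes, List.getElem_map, List.getElem_range, List.getElem_ofFn]
  rw [foldr_ofFn_eq_ofBits (fun i => Nat.ofBits (P i)) fun m => m.testBit j]
  congr 1
  funext i
  exact Nat.testBit_ofBits_lt _ _ hj

/-- The row codes of any set of rows of a reduced pattern are admissible. -/
theorem IsReducedPattern.admissible (h : IsReducedPattern P) (hn : n ≤ 5) {l : List ℕ}
    (hl : l.Subperm (rowCodes P)) : admissible n l = true := by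
  have hmem : ∀ m ∈ l, ∃ i, Nat.ofBits (P i) = m := fun m hm => mem_rowCodes.1 (hl.subset hm)
  simp only [_root_.admissible, Bool.and_eq_true, List.all_eq_true]
  refine ⟨⟨⟨?_, ?_⟩, ?_⟩, ?_⟩
  · intro r hr q hq
    obtain ⟨i, rfl⟩ := hmem r hr
    obtain ⟨k, rfl⟩ := hmem q hq
    rw [ofBits_land, bitWeight_ofBits]
    simpa using h.card_common_ne_one i k
  · intro r hr q hq s hs
    obtain ⟨i, rfl⟩ := hmem r hr
    obtain ⟨k, rfl⟩ := hmem q hq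
    obtain ⟨m, rfl⟩ := hmem s hs
    rw [ofBits_land, ofBits_land, ofBits_land, ofBits_lor, ofBits_lor, bitWeight_ofBits]
    exact decide_eq_true (h.two_lt_card_majority hn i k m)
  · intro q hq
    by_cases h3 : bitWeight n q = 3
    swap
    · simp [h3]
    by_cases h2 : l.count q < 2
    · simp [h2]
    simp only [h3, h2, List.all_eq_true, Bool.or_eq_true]
    refine Or.inr fun s hs => ?_
    -- A code repeated in `l` is repeated among the rows of `P`, which gives two distinct rows with
    -- equal support.
    have hc := (not_lt.1 h2).trans (hl.count_le q)
    rw [rowCodes, List.count_eq_countP, countP_ofFn] at hc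
    obtain ⟨a, ha, b, hb, hab⟩ := Finset.one_lt_card.1 hc
    simp only [beq_iff_eq, Finset.mem_filter_univ] at ha hb
    obtain ⟨k, rfl⟩ := hmem s hs
    have heq : P a = P b := ofBits_injective (ha.trans hb.symm)
    rw [← ha, bitWeight_ofBits] at h3
    rw [← ha, ofBits_land, beq_iff_eq]
    congr 1
    funext j
    cases hj : P a j with
    | false => simp
    | true => simp [h.le_of_equal_rows hn hab heq h3 k j hj]
  · intro j hj
    rw [List.mem_range] at hj
    have hc := hl.countP_le fun r => !r.testBit j
    rw [rowCodes, countP_ofFn] at hc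
    have h1 : (Finset.univ.filter fun i => (!(Nat.ofBits (P i)).testBit j) = true) =
        Finset.univ.filter fun i => ¬ P i ⟨j, hj⟩ = true :=
      Finset.filter_congr fun i _ => by rw [Nat.testBit_ofBits_lt _ _ hj]; simp
    have h2 := Finset.card_filter_add_card_filter_not (s := Finset.univ)
      fun i => P i ⟨j, hj⟩ = true
    have h3 := h.col ⟨j, hj⟩
    rw [h1] at hc
    rw [Finset.card_univ, Fintype.card_fin] at h2
    exact decide_eq_true (by omega)

theorem sortCodes_perm (l : List ℕ) : (sortCodes l).Perm l := List.perm_insertionSort _ l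

theorem exists_perm_of_mem_normalForms {l b : List ℕ} (hb : b ∈ normalForms n l) :
    ∃ p ∈ columnPerms n, b.Perm (l.map (permuteBits p)) := by
  obtain ⟨p, hp, rfl⟩ := List.mem_map.1 hb
  exact ⟨p, (List.mem_filter.1 hp).1, sortCodes_perm _⟩

theorem subset_addClass (L ls : List (List ℕ)) : L ⊆ addClass L ls := by
  cases ls with
  | nil => exact List.Subset.refl _
  | cons l ls =>
    rw [addClass]
    split
    · exact List.Subset.refl _
    · exact List.subset_cons_self _ _

theorem exists_mem_addClass {L ls : List (List ℕ)} (h : ls ≠ []) :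
    ∃ b ∈ addClass L ls, b ∈ ls := by
  cases ls with
  | nil => exact absurd rfl h
  | cons l ls =>
    rw [addClass]
    split
    · next h =>
      obtain ⟨b, hb, hL⟩ := List.any_eq_true.1 h
      exact ⟨b, List.mem_of_elem_eq_true hL, hb⟩
    · exact ⟨l, List.mem_cons_self, List.mem_cons_self⟩

theorem subset_classes (ls L : List (List ℕ)) : L ⊆ classes n ls L := by
  induction ls generalizing L with
  | nil => exact List.Subset.refl _
  | cons l ls ih =>
    rw [classes]
    refine List.Subset.trans ?_ (ih _)
    split
    · exact subset_addClass _ _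
    · exact List.Subset.refl _

/-- Only completeness matters: every admissible list keeps some representative. That the
representatives are pairwise inequivalent is never used, so the choice of normal forms affects only
the size of the search. -/
theorem exists_mem_classes {ls L : List (List ℕ)} {l : List ℕ} (hl : l ∈ ls)
    (ha : admissible n l = true) : ∃ b ∈ classes n ls L, b ∈ normalForms n l ++ [l] := by
  induction ls generalizing L with
  | nil => exact absurd hl List.not_mem_nil
  | cons l' ls ih =>
    rw [classes]
    rcases List.mem_cons.1 hl with rfl | hl
    · rw [if_pos ha]
      obtain ⟨b, hb, hb'⟩ := exists_mem_addClass (L := L)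
        (List.append_ne_nil_of_right_ne_nil (normalForms n l) (List.cons_ne_nil l []))
      exact ⟨b, subset_classes _ _ hb, hb'⟩
    · exact ih hl

/-- Up to a column permutation, `k` rows of a reduced pattern have the codes in a member of
`level n k`. -/
theorem IsReducedPattern.exists_mem_level (h : IsReducedPattern P) (hn : n ≤ 5) {k : ℕ}
    (hk : k ≤ n) : ∃ b ∈ level n k, b.length = k ∧
      ∃ τ : Equiv.Perm (Fin n), b.Subperm (rowCodes (P.submatrix id τ)) := by
  induction k with
  | zero => exact ⟨[], by simp [level], rfl, 1, List.nil_subperm⟩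
  | succ k ih =>
    obtain ⟨b, hb, hbk, τ, hτ⟩ := ih (by omega)
    have hQ := h.submatrix (Equiv.refl _) τ
    -- Fewer than `n` rows have been used, so some unused row of the permuted pattern extends the
    -- list.
    obtain ⟨r, hr⟩ := hτ.exists_of_length_lt (by simp [rowCodes, hbk]; omega)
    obtain ⟨i, hi⟩ := mem_rowCodes.1 (hr.subset List.mem_cons_self)
    have hrc : r ∈ rowCandidates n := by
      rw [rowCandidates, List.mem_filter, List.mem_range, ← hi, bitWeight_ofBits]
      exact ⟨Nat.ofBits_lt_two_pow _, decide_eq_true (hQ.row i)⟩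
    obtain ⟨c, hc, hc'⟩ := exists_mem_classes (n := n) (L := [])
      (ls := (level n k).flatMap fun l => (rowCandidates n).map (· :: l)) (l := r :: b)
      (List.mem_flatMap.2 ⟨b, hb, List.mem_map.2 ⟨r, hrc, rfl⟩⟩) (hQ.admissible hn hr)
    refine ⟨c, hc, ?_⟩
    rcases List.mem_append.1 hc' with hc' | hc'
    · obtain ⟨p, hp, hpc⟩ := exists_perm_of_mem_normalForms hc'
      obtain ⟨τ', rfl⟩ := exists_perm_of_mem_columnPerms hp
      refine ⟨by simp [hpc.length_eq, hbk], τ * τ', ?_⟩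
      obtain ⟨l, hl, hsub⟩ := hr
      have : (List.map (permuteBits (List.ofFn fun j => (τ' j : ℕ))) (r :: b)).Subperm _ :=
        ⟨_, hl.map _, hsub.map _⟩
      rw [map_permuteBits_rowCodes] at this
      exact hpc.subperm.trans this
    · rw [List.mem_singleton.1 hc']
      exact ⟨by simp [hbk], τ, hr⟩

end rowCodes

/-! ### From the tables to the theorem -/

theorem isRationalPattern_intPattern {n : ℕ} {M : Matrix (Fin n) (Fin n) ℤ} {d : ℤ} (hd : d ≠ 0)
    (hM : M * Mᵀ = d ^ 2 • (1 : Matrix (Fin n) (Fin n) ℤ)) : IsRationalPattern (intPattern M) := by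
  have hd' : (d : ℚ) ≠ 0 := Int.cast_ne_zero.2 hd
  refine ⟨Matrix.of fun i j => (M i j : ℚ) / d, mul_transpose_eq_one_of_row_mul fun i k => ?_,
    fun i j => by simp [intPattern, hd]⟩
  have h := congrFun (congrFun hM i) k
  rw [Matrix.mul_apply, Matrix.smul_apply, Matrix.one_apply] at h
  have h' : ∑ j, (M i j : ℚ) * M k j = d ^ 2 * if i = k then 1 else 0 := by
    have := congrArg (Int.cast : ℤ → ℚ) h
    push_cast [Matrix.transpose_apply, smul_eq_mul] at this
    exact this
  have : ∀ j, (M i j : ℚ) / d * (M k j / d) = (M i j * M k j) / d ^ 2 := fun j => by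
    field_simp
  simp only [Matrix.of_apply, this]
  rw [← Finset.sum_div, h', mul_div_cancel_left₀ _ (pow_ne_zero 2 hd')]

theorem IsReducedPattern.isRationalPattern {n : ℕ} {P : Matrix (Fin n) (Fin n) Bool}
    (h : IsReducedPattern P) (hn : n ≤ 5) {t : List (ℤ × Matrix (Fin n) (Fin n) ℤ)}
    (ht : ∀ M ∈ t, M.1 ≠ 0 ∧ M.2 * M.2ᵀ = M.1 ^ 2 • (1 : Matrix (Fin n) (Fin n) ℤ))
    (hc : tableCovers n t = true) : IsRationalPattern P := by
  obtain ⟨b, hb, hbn, τ, hτ⟩ := h.exists_mem_level hn le_rfl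
  -- At full length the sublist uses all rows, so `b` lists the rows of `P` up to row and column
  -- permutations.
  obtain ⟨σ, rfl⟩ := exists_submatrix_of_perm
    (hτ.perm_of_length_le (by rw [hbn, rowCodes, List.length_ofFn]))
  have hQ : IsReducedPattern (P.submatrix σ τ) := h.submatrix σ τ
  have key := List.all_eq_true.1 hc _ hb
  -- The transpose of a reduced pattern is reduced, so the alternative in `tableCovers` that the
  -- transposed codes are inadmissible is excluded.
  rw [Matrix.submatrix_submatrix, Function.id_comp, Function.comp_id, transposeCodes_rowCodes,
    hQ.transpose.admissible hn (List.Subperm.refl _), Bool.not_true, Bool.false_or,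
    List.any_eq_true] at key
  obtain ⟨p, hp, hmem⟩ := key
  obtain ⟨τ', rfl⟩ := exists_perm_of_mem_columnPerms hp
  rw [map_permuteBits_rowCodes] at hmem
  obtain ⟨M, hM, hM'⟩ := List.mem_flatMap.1 (List.mem_of_elem_eq_true hmem)
  have hMr := isRationalPattern_intPattern (ht M hM).1 (ht M hM).2
  have finish : ∀ N : Matrix (Fin n) (Fin n) Bool, IsRationalPattern N →
      sortCodes (rowCodes ((P.submatrix σ τ).submatrix id τ')) = sortCodes (rowCodes N) →
      IsRationalPattern P := fun N hN heq => by
    have hp := (sortCodes_perm _).symm.trans ((List.Perm.of_eq heq).trans (sortCodes_perm _))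
    obtain ⟨ρ, hρ⟩ := exists_submatrix_of_perm hp
    have hN' := hN.submatrix ρ 1
    rw [Equiv.Perm.coe_one, ← rowCodes_injective hρ] at hN'
    exact (IsRationalPattern.of_submatrix (σ := 1) (τ := τ') hN').of_submatrix
  simp only [List.mem_cons, List.not_mem_nil, or_false] at hM'
  rcases hM' with hM' | hM'
  · exact finish _ hMr hM'
  · exact finish _ hMr.transpose hM'

/-- Every unitary pattern of size at most five is the pattern of a rational orthogonal matrix. -/
theorem IsUnitaryPattern.isRationalPattern {n : ℕ} (hn : n ≤ 5) :
    ∀ P : Matrix (Fin n) (Fin n) Bool, IsUnitaryPattern P → IsRationalPattern P := by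
  induction n with
  | zero => exact fun P _ => ⟨1, by simp, fun i => i.elim0⟩
  | succ m ih =>
    intro P hP
    have ih := ih (by omega)
    by_cases hr : ∃ i, (Finset.univ.filter fun j => P i j = true).card ≤ 2
    · obtain ⟨i, hi⟩ := hr
      exact IsRationalPattern.of_row_card_le_two ih hP hi
    by_cases hc : ∃ j, (Finset.univ.filter fun i => P i j = true).card ≤ 2
    · obtain ⟨j, hj⟩ := hc
      exact (IsRationalPattern.of_row_card_le_two (P := Pᵀ) ih hP.transpose hj).of_transpose
    push Not at hr hc
    have hred : IsReducedPattern P := ⟨hP, hr, hc⟩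
    -- A row with three entries forces size at least three, leaving only the sizes with a table.
    have h3 := (hr 0).trans_le (Finset.card_le_univ _)
    rw [Fintype.card_fin] at h3
    obtain rfl | rfl | rfl : m = 2 ∨ m = 3 ∨ m = 4 := by omega
    · exact hred.isRationalPattern hn orthogonalTable3_spec tableCovers_three
    · exact hred.isRationalPattern hn orthogonalTable4_spec tableCovers_four
    · exact hred.isRationalPattern hn orthogonalTable5_spec tableCovers_five

theorem zeroPattern_eq_iff {m n K L : Type*} [Field K] [Field L] {X : Matrix m n K}
    {Y : Matrix m n L} : zeroPattern X = zeroPattern Y ↔ ∀ i j, X i j ≠ 0 ↔ Y i j ≠ 0 := by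
  classical
  rw [← Matrix.ext_iff]
  refine forall_congr' fun i => forall_congr' fun j => ?_
  by_cases hX : X i j = 0 <;> by_cases hY : Y i j = 0 <;> simp [zeroPattern, hX, hY]

/-- A complex unitary matrix of size at most five has the zero pattern of a rational orthogonal
matrix. -/
theorem exists_rationalOrthogonal_zeroPattern {n : ℕ} (hn : n ≤ 5)
    {X : Matrix (Fin n) (Fin n) ℂ} (hX : X ∈ Matrix.unitaryGroup (Fin n) ℂ) :
    ∃ Z ∈ rationalOrthogonal n, zeroPattern X = zeroPattern Z := by
  classical
  obtain ⟨Z, hZ, hP⟩ := IsUnitaryPattern.isRationalPattern hn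
    (Matrix.of fun i j => decide (X i j ≠ 0)) ⟨X, hX, fun i j => by simp⟩
  refine ⟨Z.map ((↑) : ℚ → ℝ), ⟨?_, fun i j => ⟨Z i j, rfl⟩⟩, zeroPattern_eq_iff.2 fun i j => ?_⟩
  · rw [Matrix.mem_orthogonalGroup_iff]
    have := congrArg (fun A => A.map (Rat.castHom ℝ)) hZ
    rw [Matrix.map_mul, Matrix.map_one _ (map_zero _) (map_one _)] at this
    exact this
  · simpa using hP i j

theorem mainTheorem1 (n : ℕ) (hn : n ≤ 5) :
    (∀ X ∈ Matrix.unitaryGroup (Fin n) ℂ, ∃ Y ∈ Matrix.orthogonalGroup (Fin n) ℝ,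
      zeroPattern X = zeroPattern Y) ∧
    (∀ Y ∈ Matrix.orthogonalGroup (Fin n) ℝ, ∃ Z ∈ rationalOrthogonal n,
      zeroPattern Y = zeroPattern Z) := by
  refine ⟨fun X hX => ?_, fun Y hY => ?_⟩
  · obtain ⟨Z, hZ, h⟩ := exists_rationalOrthogonal_zeroPattern hn hX
    exact ⟨Z, hZ.1, h⟩
  · have hX : Y.map ((↑) : ℝ → ℂ) ∈ Matrix.unitaryGroup (Fin n) ℂ := by
      rw [Matrix.mem_orthogonalGroup_iff] at hY
      refine mem_unitaryGroup_of_row_mul fun i k => ?_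
      have := congrArg ((↑) : ℝ → ℂ) (congrFun (congrFun hY i) k)
      rw [Matrix.mul_apply, Matrix.one_apply] at this
      split_ifs at this ⊢ <;> simpa using this
    obtain ⟨Z, hZ, h⟩ := exists_rationalOrthogonal_zeroPattern hn hX
    refine ⟨Z, hZ, ?_⟩
    rw [← h, zeroPattern_eq_iff]
    simp
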